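/- Let $p$ be a prime, $S$ a finite $p$-group and $\mathcal F$ a saturated fusion system over $S$. For $Q\le S$ let $N_{\mathcal F}(Q)$ be the fusion system over $N_S(Q)$ whose morphisms $U\to V$ (for $U,V\le N_S(Q)$) are those $\varphi\in\mathrm{Hom}_{\mathcal F}(U,V)$ that extend to some $\tilde\varphi\in\mathrm{Hom}_{\mathcal F}(UQ,VQ)$ with $\tilde\varphi(Q)=Q$; the same definition is used for every (not necessarily saturated) fusion system. For a fusion system $\mathcal E$ let $O_p(\mathcal E)$ be the largest subgroup $R$ with $N_{\mathcal E}(R)=\mathcal E$, and call a subgroup $Q$ of the underlying group of $\mathcal E$ weakly centric-radical in $\mathcal E$ if $O_p(N_{\mathcal E}(Q))=Q$. Write $\mathcal E^{\mathfrak{cr}}$ for the set of these subgroups. A weakly centric-radical chain in $\mathcal F$ of length $n\ge 0$ is a chain $\sigma\colon Q_0<Q_1<\dots<Q_n$ of subgroups of $S$ such that $N_{\mathcal F}(Q_0)=\mathcal F$, $O_p(\mathcal F)<Q_1$ (if $n\ge1$), and $Q_i$ is weakly centric-radical in $N_{\mathcal F}(\sigma_{i-1})$ for $1\le i\le n$,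 where $N_{\mathcal F}(\sigma_0)=N_{\mathcal F}(Q_0)$ and $N_{\mathcal F}(\sigma_i)=N_{N_{\mathcal F}(\sigma_{i-1})}(Q_i)$. Let $\mathrm{rank}_w(\mathcal F)$ be the length of a longest weakly centric-radical chain in $\mathcal F$. Let $\mathcal F^{e}$ be the set of $\mathcal F$-essential subgroups, i.e. of the subgroups $Q\le S$ that are fully $\mathcal F$-normalised and $\mathcal F$-centric and for which $\mathrm{Out}_{\mathcal F}(Q)$ has a strongly $p$-embedded subgroup. Then $\mathrm{rank}_w(\mathcal F)=2$ if and only if both of the following hold: (1) $\mathcal F^{e}\setminus\{O_p(\mathcal F)\}\neq\emptyset$; (2) $N_{\mathcal F}(Q)^{\mathfrak{cr}}\setminus\{Q,N_S(Q)\}=\emptyset$ for every $Q\in\mathcal F^{\mathfrak{cr}}\setminus\{S,O_p(\mathcal F)\}$. -/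

import Mathlib

universe u

/-- `ψ : A → B` extends `φ : U → V`, where `U, A` and `V, B` are subgroups of one group:
`U ≤ A` and `ψ x = φ x` for all `x ∈ U`. -/
def Extends {G : Type u} [Group G] {U V A B : Subgroup G} (ψ : A →* B) (φ : U →* V) : Prop :=
  ∃ h : U ≤ A, ∀ x : U, (ψ (Subgroup.inclusion h x) : G) = φ x

/-- `ψ(Q) = Q`, for a homomorphism `ψ : A → B` of subgroups of `G` and a subgroup `Q ≤ A`. -/
def Stabilises {G : Type u} [Group G] {A B : Subgroup G} (ψ : A →* B) (Q : Subgroup G) : Prop :=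
  Q ≤ A ∧ (Q.subgroupOf A).map (B.subtype.comp ψ) = Q

/-- A fusion system over a subgroup `S` of an ambient group `G`. The objects are the subgroups of
`S`; `Hom P Q` is the set of morphisms from `P` to `Q` (empty unless `P` and `Q` are subgroups of
`S`). Taking `S = ⊤` gives fusion systems over a group `G`; the ambient group is there so
that fusion systems over different subgroups of `S` can be compared. -/
@[ext]
structure FusionSystem (G : Type u) [Group G] where
  /-- The underlying group. -/
  S : Subgroup G
  /-- The morphisms. -/
  Hom : (P Q : Subgroup G) → Set (P →* Q)
  le_of_mem : ∀ {P Q : Subgroup G} {φ : P →* Q}, φ ∈ Hom P Q → P ≤ S ∧ Q ≤ S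
  /-- The homomorphisms `P → Q` that are conjugation by an element of `S` are morphisms. -/
  conj_mem : ∀ {P Q : Subgroup G}, P ≤ S → Q ≤ S → ∀ g ∈ S, ∀ φ : P →* Q,
    (∀ x : P, (φ x : G) = g * x * g⁻¹) → φ ∈ Hom P Q
  injective : ∀ {P Q : Subgroup G} {φ : P →* Q}, φ ∈ Hom P Q → Function.Injective φ
  comp_mem : ∀ {P Q R : Subgroup G} {φ : P →* Q} {ψ : Q →* R},
    φ ∈ Hom P Q → ψ ∈ Hom Q R → ψ.comp φ ∈ Hom P R
  /-- Every morphism is an isomorphism of the category followed by an inclusion. -/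
  exists_iso : ∀ {P Q : Subgroup G} {φ : P →* Q}, φ ∈ Hom P Q →
    ∃ (R : Subgroup G) (hR : R ≤ Q) (e : P ≃* R), e.toMonoidHom ∈ Hom P R ∧
      e.symm.toMonoidHom ∈ Hom R P ∧ φ = (Subgroup.inclusion hR).comp e.toMonoidHom

/-- `G` has a strongly `p`-embedded subgroup: a proper subgroup `H` of order divisible by `p` such
that `H ∩ gHg⁻¹` has order prime to `p` for all `g ∉ H`. -/
def HasStronglyEmbedded (p : ℕ) (G : Type u) [Group G] : Prop :=
  ∃ H : Subgroup G, H ≠ ⊤ ∧ p ∣ Nat.card H ∧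
    ∀ g : G, g ∉ H → ¬ p ∣ Nat.card (H ⊓ H.map (MulAut.conj g).toMonoidHom : Subgroup G)

namespace FusionSystem

variable {G : Type u} [Group G]

/-- `N_S(Q)`. -/
def NS (F : FusionSystem G) (Q : Subgroup G) : Subgroup G :=
  F.S ⊓ Subgroup.normalizer (Q : Set G)

theorem sup_le_S (F : FusionSystem G) {U Q : Subgroup G} (hU : U ≤ F.NS Q) (hQ : Q ≤ F.S) :
    U ⊔ Q ≤ F.S :=
  sup_le (hU.trans inf_le_left) hQ

/-- The normaliser `N_F(Q)`, a fusion system over `N_S(Q)`: its morphisms `U → V` are those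
`F`-morphisms that extend to an `F`-morphism `UQ → VQ` which maps `Q` onto `Q`. -/
def normalizer (F : FusionSystem G) (Q : Subgroup G) (hQ : Q ≤ F.S) : FusionSystem G where
  S := F.NS Q
  Hom U V := {φ | U ≤ F.NS Q ∧ V ≤ F.NS Q ∧ φ ∈ F.Hom U V ∧
    ∃ ψ ∈ F.Hom (U ⊔ Q) (V ⊔ Q), Extends ψ φ ∧ Stabilises ψ Q}
  le_of_mem h := ⟨h.1, h.2.1⟩
  conj_mem := by
    intro U V hU hV g hg φ hφ
    refine ⟨hU, hV, F.conj_mem (hU.trans inf_le_left) (hV.trans inf_le_left) g hg.1 φ hφ, ?_⟩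
    have hgQ := hg.2
    have key : ∀ x ∈ U ⊔ Q, g * x * g⁻¹ ∈ V ⊔ Q := by
      have h1 : U ⊔ Q ≤ (V ⊔ Q).comap (MulAut.conj g).toMonoidHom := by
        refine sup_le ?_ ?_
        · intro x hx
          have := (φ ⟨x, hx⟩).2
          rw [hφ ⟨x, hx⟩] at this
          exact (le_sup_left : V ≤ V ⊔ Q) this
        · intro x hx
          exact (le_sup_right : Q ≤ V ⊔ Q) ((Subgroup.mem_normalizer_iff.1 hgQ x).1 hx)
      intro x hx
      exact h1 hx
    let ψ : (U ⊔ Q : Subgroup G) →* (V ⊔ Q : Subgroup G) :=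
      ((MulAut.conj g).toMonoidHom.comp (U ⊔ Q).subtype).codRestrict (V ⊔ Q)
        (fun x => key x x.2)
    have hψ : ∀ x, (ψ x : G) = g * x * g⁻¹ := fun x => rfl
    refine ⟨ψ, F.conj_mem (F.sup_le_S hU hQ) (F.sup_le_S hV hQ) g hg.1 ψ hψ,
      ⟨le_sup_left, fun x => ?_⟩, le_sup_right, ?_⟩
    · rw [hψ, hφ]; rfl
    · ext y
      constructor
      · rintro ⟨x, hx, rfl⟩
        exact (Subgroup.mem_normalizer_iff.1 hgQ x).1 hx
      · intro hy
        have hy' : g⁻¹ * y * g ∈ Q := (Subgroup.mem_normalizer_iff''.1 hgQ y).1 hy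
        refine ⟨⟨g⁻¹ * y * g, (le_sup_right : Q ≤ U ⊔ Q) hy'⟩, hy', ?_⟩
        change g * (g⁻¹ * y * g) * g⁻¹ = y
        group
  injective h := F.injective h.2.2.1
  comp_mem := by
    rintro U V W φ χ ⟨hU, hV, hφ, ψ, hψ, ⟨h1, hψφ⟩, hs, hψQ⟩ ⟨-, hW, hχ, ω, hω, ⟨h2, hωχ⟩, ht, hωQ⟩
    refine ⟨hU, hW, F.comp_mem hφ hχ, ω.comp ψ, F.comp_mem hψ hω, ⟨h1, fun x => ?_⟩, hs, ?_⟩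
    · have : ψ (Subgroup.inclusion h1 x) = Subgroup.inclusion h2 (φ x) := Subtype.ext (hψφ x)
      simp only [MonoidHom.comp_apply, this, hωχ]
    · ext y
      constructor
      · rintro ⟨x, hx, rfl⟩
        have hx' : (ψ x : G) ∈ Q := hψQ.le ⟨x, hx, rfl⟩
        exact hωQ.le ⟨ψ x, hx', rfl⟩
      · intro hy
        obtain ⟨z, hz, rfl⟩ := hωQ.ge hy
        obtain ⟨x, hx, hxz⟩ := hψQ.ge (show (z : G) ∈ Q from hz)
        have : ψ x = z := Subtype.ext hxz
        exact ⟨x, hx, by rw [← this]; rfl⟩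
  exists_iso := by
    rintro U V φ ⟨hU, hV, hφ, ψ, hψ, ⟨h1, hψφ⟩, hs, hψQ⟩
    obtain ⟨R, hR, e, he, he', rfl⟩ := F.exists_iso hφ
    obtain ⟨R', hR', e₁, he₁, he₁', rfl⟩ := F.exists_iso hψ
    have hval : ∀ x : U, (e₁ (Subgroup.inclusion h1 x) : G) = e x := fun x => hψφ x
    have hRR : R' = R ⊔ Q := by
      have hRle : R ≤ R' := by
        intro y hy
        obtain ⟨x, hx⟩ := e.surjective ⟨y, hy⟩
        have := (e₁ (Subgroup.inclusion h1 x)).2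
        rw [hval x, hx] at this
        exact this
      have hQle : Q ≤ R' := by
        intro y hy
        obtain ⟨x, hx, rfl⟩ := hψQ.ge hy
        exact (e₁ x).2
      refine le_antisymm ?_ (sup_le hRle hQle)
      intro y hy
      obtain ⟨⟨x, hx⟩, hxy⟩ := e₁.surjective ⟨y, hy⟩
      have hle : U ⊔ Q ≤ (((R ⊔ Q).subgroupOf R').comap e₁.toMonoidHom).map (U ⊔ Q).subtype := by
        refine sup_le ?_ ?_
        · intro u hu
          refine ⟨Subgroup.inclusion h1 ⟨u, hu⟩, ?_, rfl⟩
          change (e₁ (Subgroup.inclusion h1 ⟨u, hu⟩) : G) ∈ R ⊔ Q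
          rw [hval]
          exact (le_sup_left : R ≤ R ⊔ Q) (e ⟨u, hu⟩).2
        · intro u hu
          refine ⟨⟨u, hs hu⟩, ?_, rfl⟩
          exact (le_sup_right : Q ≤ R ⊔ Q) (hψQ.le ⟨⟨u, hs hu⟩, hu, rfl⟩)
      obtain ⟨z, hz, hzx⟩ := hle hx
      have hzx' : z = ⟨x, hx⟩ := Subtype.ext hzx
      subst hzx'
      have hz' : (e₁ ⟨x, hx⟩ : G) ∈ R ⊔ Q := hz
      rw [hxy] at hz'
      exact hz'
    subst hRR
    have hRN : R ≤ F.NS Q := hR.trans hV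
    refine ⟨R, hR, e, ⟨hU, hRN, he, e₁.toMonoidHom, he₁, ⟨h1, hval⟩, hs, hψQ⟩,
      ⟨hRN, hU, he', e₁.symm.toMonoidHom, he₁', ⟨le_sup_left, fun x => ?_⟩, le_sup_right, ?_⟩, rfl⟩
    · have : Subgroup.inclusion (le_sup_left : R ≤ R ⊔ Q) x
          = e₁ (Subgroup.inclusion h1 (e.symm x)) := by
        apply Subtype.ext
        rw [hval]
        simp
      change ((e₁.symm (Subgroup.inclusion le_sup_left x) : (U ⊔ Q : Subgroup G)) : G) = e.symm x
      rw [this]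
      simp
    · ext y
      constructor
      · rintro ⟨x, hx, rfl⟩
        obtain ⟨z, hz, hzx⟩ := hψQ.ge (show (x : G) ∈ Q from hx)
        have : e₁ z = x := Subtype.ext hzx
        rw [← this]
        change ((e₁.symm (e₁ z) : (U ⊔ Q : Subgroup G)) : G) ∈ Q
        rw [e₁.symm_apply_apply]
        exact hz
      · intro hy
        refine ⟨e₁ ⟨y, hs hy⟩, hψQ.le ⟨⟨y, hs hy⟩, hy, rfl⟩, ?_⟩
        change ((e₁.symm (e₁ ⟨y, hs hy⟩) : (U ⊔ Q : Subgroup G)) : G) = y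
        rw [e₁.symm_apply_apply]

/-- `Q` is normal in `F`: `N_F(Q) = F`. -/
def IsNormal (F : FusionSystem G) (Q : Subgroup G) : Prop :=
  ∃ hQ : Q ≤ F.S, F.normalizer Q hQ = F

/-- `O_p(F)`, the largest subgroup of `S` that is normal in `F` (the subgroup generated by all
normal ones, which is again normal in `F`). -/
def Op (F : FusionSystem G) : Subgroup G :=
  sSup {Q | F.IsNormal Q}

/-- `e` is an isomorphism of the category `F`. -/
def IsIso (F : FusionSystem G) {P Q : Subgroup G} (e : P ≃* Q) : Prop :=
  e.toMonoidHom ∈ F.Hom P Q ∧ e.symm.toMonoidHom ∈ F.Hom Q P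

/-- `P` and `Q` are `F`-conjugate. -/
def IsConj (F : FusionSystem G) (P Q : Subgroup G) : Prop :=
  ∃ e : P ≃* Q, F.IsIso e

/-- `Aut_F(Q)`. -/
def Aut (F : FusionSystem G) (Q : Subgroup G) (hQ : Q ≤ F.S) : Subgroup (MulAut Q) where
  carrier := {α | α.toMonoidHom ∈ F.Hom Q Q}
  one_mem' := F.conj_mem hQ hQ 1 F.S.one_mem _ (fun x => by simp)
  mul_mem' := fun {_ _} ha hb => F.comp_mem hb ha
  inv_mem' := by
    intro α hα
    obtain ⟨R, hR, e, he, he', h⟩ := F.exists_iso hα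
    have hRQ : R = Q := by
      refine le_antisymm hR fun x hx => ?_
      obtain ⟨y, hy⟩ := α.surjective ⟨x, hx⟩
      have h2 := DFunLike.congr_fun h y
      have h3 : (α y : G) = e y := congrArg Subtype.val h2
      rw [hy] at h3
      change x = e y at h3
      rw [h3]
      exact (e y).2
    subst hRQ
    have : α = e := by
      ext x
      exact congrArg Subtype.val (DFunLike.congr_fun h x)
    subst this
    exact he'

/-- `Aut_S(Q)`: the automorphisms of `Q` that are conjugation by an element of `N_S(Q)`. -/
def AutS (F : FusionSystem G) (Q : Subgroup G) : Subgroup (MulAut Q) :=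
  (F.S.subgroupOf (Subgroup.normalizer (Q : Set G))).map Q.normalizerMonoidHom

/-- `Inn(Q)` is normal in `Aut(Q)`. -/
instance inn_normal (Q : Subgroup G) :
    ((MulAut.conj : Q →* MulAut Q).range).Normal := by
  constructor
  rintro _ ⟨x, rfl⟩ α
  refine ⟨α x, ?_⟩
  ext y
  simp [MulAut.conj_apply]

/-- `Out_F(Q) = Aut_F(Q) / Inn(Q)`. -/
abbrev Out (F : FusionSystem G) (Q : Subgroup G) (hQ : Q ≤ F.S) : Type u :=
  F.Aut Q hQ ⧸ ((MulAut.conj : Q →* MulAut Q).range).subgroupOf (F.Aut Q hQ)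

/-- `Q` is fully `F`-automised: `Aut_S(Q)` is a Sylow `p`-subgroup of `Aut_F(Q)`. -/
def IsFullyAutomised (F : FusionSystem G) (p : ℕ) (Q : Subgroup G) : Prop :=
  ∃ hQ : Q ≤ F.S, ∃ T : Sylow p (F.Aut Q hQ),
    (T : Subgroup (F.Aut Q hQ)) = (F.AutS Q).subgroupOf (F.Aut Q hQ)

/-- `N_φ = {g ∈ N_S(P) | φ c_g φ⁻¹ ∈ Aut_S(Q)}`, for an isomorphism `φ : P → Q`. -/
def Nphi (F : FusionSystem G) {P Q : Subgroup G} (φ : P ≃* Q) : Subgroup G :=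
  F.S ⊓ ((F.AutS Q).comap ((MulAut.congr φ).toMonoidHom.comp P.normalizerMonoidHom)).map
    (Subgroup.normalizer (P : Set G)).subtype

/-- `Q` is `F`-receptive: each `F`-isomorphism `φ : P → Q` extends to an `F`-morphism
`N_φ → S`. -/
def IsReceptive (F : FusionSystem G) (Q : Subgroup G) : Prop :=
  Q ≤ F.S ∧ ∀ (P : Subgroup G) (φ : P ≃* Q), F.IsIso φ →
    ∃ ψ ∈ F.Hom (F.Nphi φ) F.S, Extends ψ φ.toMonoidHom

/-- `F` is saturated: each subgroup of `S` is `F`-conjugate to one that is fully `F`-automised and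
`F`-receptive. -/
def IsSaturated (F : FusionSystem G) (p : ℕ) : Prop :=
  ∀ P : Subgroup G, P ≤ F.S →
    ∃ Q : Subgroup G, F.IsConj P Q ∧ F.IsFullyAutomised p Q ∧ F.IsReceptive Q

/-- `Q` is fully `F`-normalised. -/
def IsFullyNormalised (F : FusionSystem G) (Q : Subgroup G) : Prop :=
  Q ≤ F.S ∧ ∀ P : Subgroup G, F.IsConj P Q → Nat.card (F.NS P) ≤ Nat.card (F.NS Q)

/-- `Q` is `F`-centric: `C_S(P) = Z(P)` for all `F`-conjugates `P` of `Q`. -/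
def IsCentric (F : FusionSystem G) (Q : Subgroup G) : Prop :=
  Q ≤ F.S ∧ ∀ P : Subgroup G, F.IsConj P Q →
    F.S ⊓ Subgroup.centralizer (P : Set G) = (Subgroup.center P).map P.subtype

/-- `Q` is `F`-essential. -/
def IsEssential (F : FusionSystem G) (p : ℕ) (Q : Subgroup G) : Prop :=
  F.IsFullyNormalised Q ∧ F.IsCentric Q ∧
    ∃ hQ : Q ≤ F.S, HasStronglyEmbedded p (F.Out Q hQ)

/-- `Q ≤ S` is weakly centric-radical in `F`: `O_p(N_F(Q)) = Q`. -/
def IsWeaklyCentricRadical (F : FusionSystem G) (Q : Subgroup G) : Prop :=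
  ∃ hQ : Q ≤ F.S, (F.normalizer Q hQ).Op = Q

/-- With `E = N_F(σ_{i-1})` and `L = [Q_i, …, Q_n]`: each `Q_j`, `i ≤ j ≤ n`, is weakly
centric-radical in `N_F(σ_{j-1})`, where `N_F(σ_j)` is defined recursively by
`N_F(σ_j) = N_{N_F(σ_{j-1})}(Q_j)`. -/
def SuccessivelyRadical (E : FusionSystem G) : List (Subgroup G) → Prop
  | [] => True
  | Q :: L => ∃ hQ : Q ≤ E.S, E.IsWeaklyCentricRadical Q ∧
      SuccessivelyRadical (E.normalizer Q hQ) L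

/-- With `L = [Q₁, …, Q_n]`, the chain `Q₀ < Q₁ < ⋯ < Q_n` is a weakly centric-radical chain in
`F`: `Q_i` is weakly centric-radical in `N_F(σ_{i-1})` for `1 ≤ i ≤ n`, where `σ_i` is the chain
`Q₀ < ⋯ < Q_i`, `N_F(Q₀) = F`, and `O_p(F) < Q₁` (if `n ≥ 1`). Its length is `n`. -/
def IsWeaklyCentricRadicalChain (F : FusionSystem G) (Q₀ : Subgroup G)
    (L : List (Subgroup G)) : Prop :=
  (Q₀ :: L).IsChain (· < ·) ∧
    (∃ hQ₀ : Q₀ ≤ F.S, F.normalizer Q₀ hQ₀ = F ∧ SuccessivelyRadical (F.normalizer Q₀ hQ₀) L) ∧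
    ∀ Q₁ ∈ L.head?, F.Op < Q₁

/-- The weakly local rank `rank_w(F)`: the length of a longest weakly centric-radical chain,
i.e. the supremum of all lengths (computed in `ℕ∞`; it is a maximum when `S` is finite). -/
noncomputable def weakRank (F : FusionSystem G) : ℕ∞ :=
  ⨆ (Q₀ : Subgroup G) (L : List (Subgroup G)) (_ : F.IsWeaklyCentricRadicalChain Q₀ L),
    (L.length : ℕ∞)

end FusionSystem

/-!
The proof separates the two inequalities.

A weakly centric-radical subgroup of a fusion system `E` over a finite `p`-group contains every
normal subgroup `R` of `E` (`FusionSystem.IsWeaklyCentricRadical.le_of_isNormal`), because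
`R ∩ N(P)` is normal in `N_E(P)`. Hence `P ≠ Q, N_S(Q)` as in condition (2) satisfies
`Q < P < N_S(Q)`, and `O_p(F) < Q < P < N_{N_S(Q)}(P)` is a chain of length three; conversely the
first three terms `Q₁ < Q₂ < Q₃` of a longer chain violate (2). So (2) says that the rank is at
most two (`FusionSystem.weakRank_le_two_iff`). In the same way the rank is at least two if and only
if there is a weakly centric-radical subgroup `Q` with `O_p(F) < Q < S`.

It remains to compare the existence of such a `Q` with (1). An essential subgroup is different
from `S` and weakly centric-radical, since a group with a strongly `p`-embedded subgroup has no
non-trivial normal `p`-subgroup. For the converse, suppose that `O_p(F)` is the only essential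
subgroup, if there is any. A form of Alperin's fusion theorem (`FusionSystem.liftsToS_of_Op_lt`)
then shows that each morphism defined on a subgroup properly containing `O_p(F)` is a restriction
of an automorphism of `S`. It is proved by downward induction on the order of the domain: for a
fully automised and receptive `W` with `O_p(F) < W < S`, the automorphisms of `W` that extend to
`S` form a subgroup of `Aut_F(W)` which, if it were proper, would give a strongly `p`-embedded
subgroup of `Out_F(W)`. For `O_p(F) < Q < S` it follows that all morphisms of `N_F(Q)` extend to
automorphisms of `N_S(Q)` in `N_F(Q)`, so that `N_S(Q) > Q` is normal in `N_F(Q)` and `Q` is not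
weakly centric-radical.
-/

/-! ### Group theory: finite `p`-groups and strongly embedded subgroups -/

/-- Normalisers grow in finite `p`-groups, for subgroups of an ambient group. -/
theorem IsPGroup.exists_mem_normalizer_notMem {G : Type*} [Group G] {p : ℕ} [Fact p.Prime]
    {S P : Subgroup G} [Finite S] (hS : IsPGroup p S) (hP : P < S) :
    ∃ g ∈ S, g ∈ Subgroup.normalizer (P : Set G) ∧ g ∉ P := by
  have := hS.isNilpotent
  have hlt : P.subgroupOf S < ⊤ :=
    lt_top_iff_ne_top.2 fun h => hP.not_ge (Subgroup.subgroupOf_eq_top.1 h)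
  obtain ⟨g, hg, hgP⟩ := SetLike.exists_of_lt (Group.normalizerCondition_of_isNilpotent _ hlt)
  rw [← Subgroup.subgroupOf_normalizer_eq hP.le] at hg
  exact ⟨g, g.2, hg, hgP⟩

/-- An element which conjugates a finite subgroup into itself normalises it. -/
theorem Subgroup.mem_normalizer_of_finite {G : Type*} [Group G] {P : Subgroup G} [Finite P] {g : G}
    (h : ∀ x ∈ P, g * x * g⁻¹ ∈ P) : g ∈ Subgroup.normalizer (P : Set G) :=
  mem_normalizer_fintype (S := (P : Set G)) h

/-- A finite group with a strongly `p`-embedded subgroup has no non-trivial normal `p`-subgroup. If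
`x ∈ H` has order `p`, then `x` centralises some `1 ≠ y ∈ N`, so `y ∈ H`; now the normaliser of
`H ∩ N` in `N` lies in `H`, so `N ≤ H`, and `N` lies in all conjugates of `H`. -/
theorem HasStronglyEmbedded.eq_bot_of_normal {p : ℕ} [Fact p.Prime] {X : Type*} [Group X]
    [Finite X] (hX : HasStronglyEmbedded p X) (N : Subgroup X) [N.Normal] (hN : IsPGroup p N) :
    N = ⊥ := by
  obtain ⟨H, hH, hpH, hse⟩ := hX
  have mem_of {g a : X} (ha : a ≠ 1) (haN : a ∈ N) (haH : a ∈ H) (hag : g⁻¹ * a * g ∈ H) :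
      g ∈ H := by
    by_contra hg
    refine hse g hg ?_
    let b : (H ⊓ H.map (MulAut.conj g).toMonoidHom : Subgroup X) :=
      ⟨a, haH, g⁻¹ * a * g, hag, by simp [mul_assoc]⟩
    have hb : b ≠ 1 := fun h => ha (congrArg Subtype.val h)
    have hab : orderOf b = orderOf (⟨a, haN⟩ : N) := by
      rw [← Subgroup.orderOf_coe, ← Subgroup.orderOf_coe]
    exact (hab ▸ hN.dvd_orderOf (g := ⟨a, haN⟩) fun h => ha (congrArg Subtype.val h)).trans
      (orderOf_dvd_natCard b)
  by_contra hne
  obtain ⟨x, hx⟩ := exists_prime_orderOf_dvd_card' p hpH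
  -- the `p`-group `⟨x⟩` has a fixed point `y ≠ 1` on `N`
  obtain ⟨y, hyN, hy1, hyx⟩ : ∃ y ∈ N, y ≠ 1 ∧ (x : X) * y * (x : X)⁻¹ = y := by
    have hZ : IsPGroup p (Subgroup.zpowers (x : X)) := by
      refine IsPGroup.of_card (n := 1) ?_
      rw [Nat.card_zpowers, Subgroup.orderOf_coe, hx, pow_one]
    let act : MulAction (Subgroup.zpowers (x : X)) N :=
      MulAction.compHom N ((MulAut.conjNormal (H := N)).comp (Subgroup.zpowers (x : X)).subtype)
    have hpN : p ∣ Nat.card N :=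
      hN.card_eq_or_dvd.resolve_left fun h => hne (Subgroup.card_eq_one.1 h)
    obtain ⟨y, hy, hy1⟩ := hZ.exists_fixed_point_of_prime_dvd_card_of_fixed_point N hpN
      (a := 1) (fun g => map_one (MulAut.conjNormal (H := N) _))
    refine ⟨y, y.2, fun h => hy1 (Subtype.ext h.symm), ?_⟩
    have := hy ⟨(x : X), Subgroup.mem_zpowers _⟩
    exact congrArg Subtype.val this
  have hyH : y ∈ H := by
    by_contra hy
    refine hse y hy ?_
    let b : (H ⊓ H.map (MulAut.conj y).toMonoidHom : Subgroup X) :=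
      ⟨x, x.2, x, x.2, by
        change y * x * y⁻¹ = x
        rw [mul_inv_eq_iff_eq_mul, ← mul_inv_eq_iff_eq_mul.1 hyx]⟩
    have hb : orderOf b = p := by rw [← hx, ← Subgroup.orderOf_coe, ← Subgroup.orderOf_coe]
    exact hb ▸ orderOf_dvd_natCard b
  have hNH : N ≤ H := by
    by_contra hNH
    have hlt : H ⊓ N < N := lt_of_le_of_ne inf_le_right fun h => hNH (h ▸ inf_le_left)
    obtain ⟨g, hgN, hg, hgn⟩ := hN.exists_mem_normalizer_notMem hlt
    have hgy := (Subgroup.mem_normalizer_iff''.1 hg y).1 ⟨hyH, hyN⟩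
    have hgH : g ∈ H := mem_of hy1 hyN hyH hgy.1
    exact hgn ⟨hgH, hgN⟩
  obtain ⟨g, hg⟩ : ∃ g, g ∉ H := by
    by_contra! h
    exact hH (Subgroup.eq_top_iff' _ |>.2 h)
  refine hg (mem_of hy1 hyN hyH (hNH ?_))
  simpa using Subgroup.Normal.conj_mem ‹N.Normal› y hyN g⁻¹

/-- A criterion for `A ⧸ N` to have a strongly `p`-embedded subgroup: the image of a proper
subgroup `H` which contains a Sylow `p`-subgroup `T > N` of `A`, and every `k` with
`T ∩ k⁻¹ T k ≰ N`. -/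
theorem HasStronglyEmbedded.quotient_of_sylow {p : ℕ} [Fact p.Prime] {A : Type*} [Group A]
    [Finite A] (N : Subgroup A) [N.Normal] (T : Sylow p A) (H : Subgroup A)
    (hNT : N < (T : Subgroup A)) (hTH : (T : Subgroup A) ≤ H) (hH : H ≠ ⊤)
    (hk : ∀ k t : A, t ∈ T → t ∉ N → k * t * k⁻¹ ∈ T → k ∈ H) :
    HasStronglyEmbedded p (A ⧸ N) := by
  have hNH : N ≤ H := hNT.le.trans hTH
  have hmem (a : A) : (QuotientGroup.mk' N a) ∈ H.map (QuotientGroup.mk' N) ↔ a ∈ H := by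
    refine ⟨?_, fun h => ⟨a, h, rfl⟩⟩
    rintro ⟨b, hb, hba⟩
    have : b⁻¹ * a ∈ N := QuotientGroup.eq.1 hba
    simpa using H.mul_mem hb (hNH this)
  have hNp : IsPGroup p N := T.isPGroup'.to_le hNT.le
  have hconj (a : A) (ha : a ∈ H) (hap : ∃ n, a ^ p ^ n = 1) : ∃ b ∈ H, b * a * b⁻¹ ∈ T := by
    obtain ⟨n, hn⟩ := hap
    have hZ : IsPGroup p (Subgroup.zpowers (⟨a, ha⟩ : H)) := by
      rintro ⟨_, i, rfl⟩
      refine ⟨n, Subtype.ext (Subtype.ext ?_)⟩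
      change (a ^ i) ^ p ^ n = 1
      rw [← zpow_natCast, ← zpow_mul, mul_comm, zpow_mul, zpow_natCast, hn, one_zpow]
    obtain ⟨T', hT'⟩ := hZ.exists_le_sylow
    obtain ⟨b, hb⟩ := MulAction.exists_smul_eq H T' (T.subtype hTH)
    refine ⟨b, b.2, ?_⟩
    have h1 : (⟨a, ha⟩ : H) ∈ T' := hT' (Subgroup.mem_zpowers _)
    have h2 : MulAut.conj b • (⟨a, ha⟩ : H) ∈ ((b • T' : Sylow p H) : Subgroup H) :=
      Subgroup.smul_mem_pointwise_smul _ _ _ h1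
    rw [hb, Sylow.coe_subtype] at h2
    exact h2
  refine ⟨H.map (QuotientGroup.mk' N), ?_, ?_, ?_⟩
  · intro h
    refine hH ((Subgroup.eq_top_iff' _).2 fun a => (hmem a).1 ?_)
    rw [h]
    trivial
  · obtain ⟨t, htT, htN⟩ := SetLike.exists_of_lt hNT
    have h1 : IsPGroup p ((T : Subgroup A).map (QuotientGroup.mk' N)) := T.isPGroup'.map _
    refine (h1.card_eq_or_dvd.resolve_left fun h => htN ?_).trans
      (Subgroup.card_dvd_of_le (Subgroup.map_mono hTH))
    have h2 : QuotientGroup.mk' N t ∈ (T : Subgroup A).map (QuotientGroup.mk' N) := ⟨t, htT, rfl⟩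
    rw [Subgroup.card_eq_one.1 h] at h2
    exact (QuotientGroup.eq_one_iff t).1 h2
  · intro g
    obtain ⟨g, rfl⟩ := QuotientGroup.mk'_surjective N g
    rw [hmem]
    intro hg hdvd
    obtain ⟨⟨x, hxH, hxg⟩, hx⟩ := exists_prime_orderOf_dvd_card' p hdvd
    rw [← Subgroup.orderOf_coe] at hx
    obtain ⟨a, ha, rfl⟩ := hxH
    obtain ⟨c, hc, hca⟩ := hxg
    obtain ⟨c, hcH, rfl⟩ := hc
    have haN : a ∉ N := by
      intro h
      have h1 : QuotientGroup.mk' N a = 1 := (QuotientGroup.eq_one_iff a).2 h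
      have h2 : orderOf (QuotientGroup.mk' N a) = p := hx
      rw [h1, orderOf_one] at h2
      exact (Fact.out : p.Prime).one_lt.ne h2
    have hap : ∃ n, a ^ p ^ n = 1 := by
      have h1 : a ^ p ∈ N := by
        refine (QuotientGroup.eq_one_iff _).1 ?_
        have h2 : (QuotientGroup.mk' N a) ^ p = 1 := by
          rw [← hx]
          exact pow_orderOf_eq_one _
        simpa using h2
      obtain ⟨n, hn⟩ := hNp ⟨_, h1⟩
      refine ⟨n + 1, ?_⟩
      rw [pow_succ', pow_mul]
      exact congrArg Subtype.val hn
    have haH : g⁻¹ * a * g ∈ H := by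
      have h1 : QuotientGroup.mk' N (g * c * g⁻¹) = QuotientGroup.mk' N a := by simpa using hca
      have h2 : (g * c * g⁻¹)⁻¹ * a ∈ N := QuotientGroup.eq.1 h1
      have h3 : g⁻¹ * ((g * c * g⁻¹)⁻¹ * a) * g ∈ N := by
        simpa using Subgroup.Normal.conj_mem ‹N.Normal› _ h2 g⁻¹
      have h4 := H.mul_mem hcH (hNH h3)
      convert h4 using 1
      group
    obtain ⟨b, hb, hbT⟩ := hconj a ha hap
    obtain ⟨d, hd, hdT⟩ := hconj _ haH (by
      obtain ⟨n, hn⟩ := hap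
      refine ⟨n, ?_⟩
      have := conj_pow (i := p ^ n) (a := g⁻¹) (b := a)
      rw [inv_inv] at this
      rw [this, hn]
      simp)
    have hkH : d * g⁻¹ * b⁻¹ ∈ H := by
      refine hk _ (b * a * b⁻¹) hbT (fun h => haN ?_) ?_
      · have := Subgroup.Normal.conj_mem ‹N.Normal› _ h b⁻¹
        simpa [mul_assoc] using this
      · convert hdT using 1
        group
    refine hg ?_
    have := H.mul_mem (H.mul_mem (H.inv_mem hd) hkH) hb
    simpa [mul_assoc] using H.inv_mem this

/-! ### Morphisms of a fusion system and their restrictions -/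

section Extends

variable {G : Type*} [Group G] {U V W A B C Q : Subgroup G}

theorem Extends.apply {ψ : A →* B} {φ : U →* V} (h : Extends ψ φ) {x : G} (hU : x ∈ U)
    (hA : x ∈ A) : (ψ ⟨x, hA⟩ : G) = φ ⟨x, hU⟩ :=
  h.2 ⟨x, hU⟩

theorem Extends.trans {χ : W →* C} {ψ : A →* B} {φ : U →* V} (h : Extends χ ψ)
    (h' : Extends ψ φ) : Extends χ φ :=
  ⟨h'.1.trans h.1, fun x => (h.2 (Subgroup.inclusion h'.1 x)).trans (h'.2 x)⟩

theorem Stabilises.apply_mem {ψ : A →* B} (h : Stabilises ψ Q) {x : G} (hx : x ∈ Q)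
    (hA : x ∈ A) : (ψ ⟨x, hA⟩ : G) ∈ Q :=
  h.2.le ⟨⟨x, hA⟩, hx, rfl⟩

theorem Stabilises.exists_apply_eq {ψ : A →* B} (h : Stabilises ψ Q) {y : G} (hy : y ∈ Q) :
    ∃ x, ∃ hA : x ∈ A, x ∈ Q ∧ (ψ ⟨x, hA⟩ : G) = y := by
  obtain ⟨⟨x, hA⟩, hx, rfl⟩ := h.2.ge hy
  exact ⟨x, hA, hx, rfl⟩

/-- An injective homomorphism which maps a finite subgroup `Q` into itself maps it onto itself. -/
theorem Stabilises.of_apply_mem [Finite Q] {ψ : A →* B} (hψ : Function.Injective ψ) (hQA : Q ≤ A)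
    (h : ∀ x (hx : x ∈ Q), (ψ ⟨x, hQA hx⟩ : G) ∈ Q) : Stabilises ψ Q := by
  refine ⟨hQA, le_antisymm ?_ fun y hy => ?_⟩
  · rintro _ ⟨⟨x, hxA⟩, hx, rfl⟩
    exact h x hx
  · let f : Q → Q := fun x => ⟨ψ ⟨x, hQA x.2⟩, h x x.2⟩
    have hf : Function.Injective f := fun a b hab => by
      have hab' : ψ ⟨a, hQA a.2⟩ = ψ ⟨b, hQA b.2⟩ :=
        Subtype.ext (congrArg (fun q : Q => (q : G)) hab)
      exact Subtype.ext (congrArg (fun q : A => (q : G)) (hψ hab'))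
    obtain ⟨x, hx⟩ := (Finite.injective_iff_surjective.1 hf) ⟨y, hy⟩
    exact ⟨⟨x, hQA x.2⟩, x.2, congrArg Subtype.val hx⟩

theorem Stabilises.of_extends {χ : W →* C} {ψ : A →* B} (h : Extends χ ψ) (hQ : Stabilises ψ Q) :
    Stabilises χ Q := by
  refine ⟨hQ.1.trans h.1, le_antisymm ?_ fun y hy => ?_⟩
  · rintro _ ⟨⟨x, hxW⟩, hx, rfl⟩
    have hx : x ∈ Q := hx
    change (χ ⟨x, hxW⟩ : G) ∈ Q
    rw [h.apply (hQ.1 hx)]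
    exact hQ.apply_mem hx _
  · obtain ⟨x, hA, hx, rfl⟩ := hQ.exists_apply_eq hy
    exact ⟨⟨x, h.1 hA⟩, hx, h.apply hA _⟩

theorem Extends.of_le {χ : W →* C} {ψ : A →* B} {φ : U →* V} (h : Extends χ ψ)
    (h' : Extends χ φ) (hUA : U ≤ A) : Extends ψ φ :=
  ⟨hUA, fun x => (h.2 (Subgroup.inclusion hUA x)).symm.trans (h'.2 x)⟩

theorem Extends.apply_mem_normalizer [Finite V] {ψ : A →* B} {φ : U ≃* V}
    (h : Extends ψ φ.toMonoidHom) {g : G} (hg : g ∈ Subgroup.normalizer (U : Set G))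
    (hA : g ∈ A) : (ψ ⟨g, hA⟩ : G) ∈ Subgroup.normalizer (V : Set G) := by
  refine Subgroup.mem_normalizer_of_finite fun y hy => ?_
  obtain ⟨⟨x, hx⟩, hxy⟩ := φ.surjective ⟨y, hy⟩
  have hxy : (φ ⟨x, hx⟩ : G) = y := congrArg Subtype.val hxy
  have hxA := h.1 hx
  have hgx : g * x * g⁻¹ ∈ U := (Subgroup.mem_normalizer_iff.1 hg x).1 hx
  have key : (ψ ⟨g, hA⟩ : G) * ψ ⟨x, hxA⟩ * (ψ ⟨g, hA⟩ : G)⁻¹ = φ ⟨g * x * g⁻¹, hgx⟩ := by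
    rw [← Subgroup.coe_inv, ← Subgroup.coe_mul, ← Subgroup.coe_mul, ← map_inv, ← map_mul,
      ← map_mul]
    exact h.apply hgx (mul_mem (mul_mem hA hxA) (inv_mem hA))
  have hψx : (ψ ⟨x, hxA⟩ : G) = y := (h.apply hx hxA).trans hxy
  rw [← hψx, key]
  exact (φ _).2

theorem Stabilises.apply_mem_normalizer [Finite Q] {ψ : A →* B} (h : Stabilises ψ Q) {g : G}
    (hg : g ∈ Subgroup.normalizer (Q : Set G)) (hA : g ∈ A) :
    (ψ ⟨g, hA⟩ : G) ∈ Subgroup.normalizer (Q : Set G) := by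
  refine Subgroup.mem_normalizer_of_finite fun y hy => ?_
  obtain ⟨z, hz, hzQ, rfl⟩ := h.exists_apply_eq hy
  have hgz := (Subgroup.mem_normalizer_iff.1 hg z).1 hzQ
  rw [← Subgroup.coe_inv, ← Subgroup.coe_mul, ← Subgroup.coe_mul, ← map_inv, ← map_mul,
    ← map_mul]
  exact h.apply_mem hgz (mul_mem (mul_mem hA hz) (inv_mem hA))

theorem apply_mem_sup {ψ : A →* B} (hU : ∀ x (hA : x ∈ A), x ∈ U → (ψ ⟨x, hA⟩ : G) ∈ V)
    (hQ : ∀ x (hA : x ∈ A), x ∈ Q → (ψ ⟨x, hA⟩ : G) ∈ W) (hUA : U ≤ A) (hQA : Q ≤ A)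
    {x : G} (hx : x ∈ U ⊔ Q) (hA : x ∈ A) : (ψ ⟨x, hA⟩ : G) ∈ V ⊔ W := by
  have hle : U ⊔ Q ≤ ((V ⊔ W).comap (B.subtype.comp ψ)).map A.subtype :=
    sup_le (fun y hy => ⟨⟨y, hUA hy⟩, (le_sup_left : V ≤ V ⊔ W) (hU y _ hy), rfl⟩)
      fun y hy => ⟨⟨y, hQA hy⟩, (le_sup_right : W ≤ V ⊔ W) (hQ y _ hy), rfl⟩
  obtain ⟨z, hz, rfl⟩ := hle hx
  exact hz

end Extends

namespace FusionSystem

variable {G : Type*} [Group G] {F : FusionSystem G} {p : ℕ} {U V W A B C P Q R : Subgroup G}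

theorem finite_of_le [Finite F.S] (hQ : Q ≤ F.S) : Finite Q :=
  Finite.of_injective _ (Subgroup.inclusion_injective hQ)

/-- Each homomorphism which is a restriction of a morphism is a morphism. -/
theorem mem_of_extends {ψ : A →* B} (hψ : ψ ∈ F.Hom A B) {φ : U →* V} (h : Extends ψ φ)
    (hV : V ≤ F.S) : φ ∈ F.Hom U V := by
  have hA := (F.le_of_mem hψ).1
  have hincl : Subgroup.inclusion h.1 ∈ F.Hom U A :=
    F.conj_mem (h.1.trans hA) hA 1 F.S.one_mem _ fun x => by simp
  obtain ⟨R, hR, e, he, -, heq⟩ := F.exists_iso (F.comp_mem hincl hψ)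
  have hval (x : U) : (φ x : G) = e x := by
    rw [← h.2 x]
    exact congrArg Subtype.val (DFunLike.congr_fun heq x)
  have hRV : R ≤ V := fun y hy => by
    obtain ⟨x, hx⟩ := e.surjective ⟨y, hy⟩
    have := (φ x).2
    rwa [hval, hx] at this
  have hφ : φ = (Subgroup.inclusion hRV).comp e.toMonoidHom := by
    ext x
    exact hval x
  rw [hφ]
  exact F.comp_mem he (F.conj_mem (hRV.trans hV) hV 1 F.S.one_mem _ fun x => by simp)

theorem exists_restrict {ψ : A →* B} (hψ : ψ ∈ F.Hom A B) (hU : U ≤ A) (hV : V ≤ F.S)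
    (h : ∀ x (hx : x ∈ U), (ψ ⟨x, hU hx⟩ : G) ∈ V) : ∃ φ ∈ F.Hom U V, Extends ψ φ := by
  let φ : U →* V := (B.subtype.comp (ψ.comp (Subgroup.inclusion hU))).codRestrict V
    fun x => h x x.2
  have hφ : Extends ψ φ := ⟨hU, fun x => rfl⟩
  exact ⟨φ, mem_of_extends hψ hφ hV, hφ⟩

theorem IsIso.symm {e : P ≃* Q} (h : F.IsIso e) : F.IsIso e.symm :=
  ⟨h.2, h.1⟩

theorem IsIso.trans {e : P ≃* Q} {e' : Q ≃* R} (h : F.IsIso e) (h' : F.IsIso e') :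
    F.IsIso (e.trans e') :=
  ⟨F.comp_mem h.1 h'.1, F.comp_mem h'.2 h.2⟩

/-- A bijective morphism is an isomorphism of the category. -/
theorem IsIso.of_mem {e : P ≃* Q} (he : e.toMonoidHom ∈ F.Hom P Q) : F.IsIso e := by
  obtain ⟨R, hR, e', h1, h2, heq⟩ := F.exists_iso he
  have hval (x : P) : (e x : G) = e' x := congrArg Subtype.val (DFunLike.congr_fun heq x)
  obtain rfl : R = Q := le_antisymm hR fun y hy => by
    obtain ⟨x, hx⟩ := e.surjective ⟨y, hy⟩
    have := (e' x).2
    rwa [← hval, hx] at this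
  obtain rfl : e = e' := by
    ext x
    exact hval x
  exact ⟨h1, h2⟩

/-! ### Normalisers and normal subgroups of a fusion system -/

theorem le_NS (hQ : Q ≤ F.S) : Q ≤ F.NS Q :=
  le_inf hQ Subgroup.le_normalizer

theorem NS_le_S : F.NS Q ≤ F.S :=
  inf_le_left

/-- In the definition of the normaliser it does not matter on which subgroup containing `U ⊔ Q` the
extension of a morphism is defined. -/
theorem mem_normalizer_of_extends (hQ : Q ≤ F.S) {φ : U →* V} (hU : U ≤ F.NS Q) (hV : V ≤ F.NS Q)
    {ψ : A →* B} (hψ : ψ ∈ F.Hom A B) (h : Extends ψ φ) (hs : Stabilises ψ Q) :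
    φ ∈ (F.normalizer Q hQ).Hom U V := by
  have hUQ : U ⊔ Q ≤ A := sup_le h.1 hs.1
  have hUV : ∀ x (hA : x ∈ A), x ∈ U → (ψ ⟨x, hA⟩ : G) ∈ V := fun x hA hx => by
    rw [h.apply hx hA]
    exact (φ _).2
  obtain ⟨χ, hχ, hψχ⟩ := exists_restrict hψ hUQ (F.sup_le_S hV hQ) fun x hx =>
    apply_mem_sup hUV (fun _ hA hx => hs.apply_mem hx hA) h.1 hs.1 hx _
  refine ⟨hU, hV, mem_of_extends hψ h (hV.trans NS_le_S), χ, hχ,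
    ⟨le_sup_left, fun x => ?_⟩, le_sup_right, le_antisymm ?_ fun y hy => ?_⟩
  · rw [← h.2 x, ← hψχ.2]
    rfl
  · rintro _ ⟨⟨x, hx⟩, hxQ, rfl⟩
    change (χ ⟨x, hx⟩ : G) ∈ Q
    rw [← hψχ.apply hx (hUQ hx)]
    exact hs.apply_mem hxQ _
  · obtain ⟨x, hA, hx, rfl⟩ := hs.exists_apply_eq hy
    have hx' : x ∈ U ⊔ Q := (le_sup_right : Q ≤ U ⊔ Q) hx
    exact ⟨⟨x, hx'⟩, hx, (hψχ.apply hx' hA).symm⟩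

theorem IsNormal.le_S (h : F.IsNormal R) : R ≤ F.S :=
  h.1

theorem IsNormal.NS_eq (h : F.IsNormal R) : F.NS R = F.S := by
  obtain ⟨hR, h⟩ := h
  exact congrArg FusionSystem.S h

theorem IsNormal.S_le_normalizer (h : F.IsNormal R) : F.S ≤ Subgroup.normalizer (R : Set G) :=
  inf_eq_left.1 h.NS_eq

theorem IsNormal.exists_extends (h : F.IsNormal R) {φ : U →* V} (hφ : φ ∈ F.Hom U V) :
    ∃ ψ ∈ F.Hom (U ⊔ R) (V ⊔ R), Extends ψ φ ∧ Stabilises ψ R := by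
  obtain ⟨hR, h⟩ := h
  rw [← h] at hφ
  exact hφ.2.2.2

theorem IsNormal.of_extends (hR : R ≤ F.S) (hS : F.S ≤ Subgroup.normalizer (R : Set G))
    (h : ∀ (U V : Subgroup G), ∀ φ ∈ F.Hom U V, ∃ (A B : Subgroup G),
      ∃ ψ ∈ F.Hom A B, Extends ψ φ ∧ Stabilises ψ R) : F.IsNormal R := by
  have hNS : F.NS R = F.S := inf_eq_left.2 hS
  refine ⟨hR, FusionSystem.ext hNS ?_⟩
  funext U V
  ext φ
  refine ⟨fun hφ => hφ.2.2.1, fun hφ => ?_⟩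
  obtain ⟨hU, hV⟩ := F.le_of_mem hφ
  obtain ⟨A, B, ψ, hψ, hext, hs⟩ := h U V φ hφ
  exact mem_normalizer_of_extends hR (hNS ▸ hU) (hNS ▸ hV) hψ hext hs

/-- A normal subgroup is mapped onto itself by all morphisms defined on it. -/
theorem IsNormal.stabilises (h : F.IsNormal R) {φ : U →* V} (hφ : φ ∈ F.Hom U V) (hR : R ≤ U) :
    Stabilises φ R := by
  obtain ⟨ψ, -, hext, hs⟩ := h.exists_extends hφ
  refine ⟨hR, le_antisymm ?_ fun y hy => ?_⟩
  · rintro _ ⟨⟨x, hx⟩, hxR, rfl⟩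
    change (φ ⟨x, hx⟩ : G) ∈ R
    rw [← hext.apply hx (hs.1 hxR)]
    exact hs.apply_mem hxR _
  · obtain ⟨x, hA, hx, rfl⟩ := hs.exists_apply_eq hy
    exact ⟨⟨x, hR hx⟩, hx, (hext.apply (hR hx) hA).symm⟩

theorem isNormal_bot [Finite F.S] : F.IsNormal ⊥ := by
  refine IsNormal.of_extends bot_le (by rw [Subgroup.normalizer_eq_top]; exact le_top)
    fun U V φ hφ => ⟨U, V, φ, hφ, ⟨le_rfl, fun x => rfl⟩, ?_⟩
  refine Stabilises.of_apply_mem (F.injective hφ) bot_le fun x hx => ?_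
  obtain rfl := Subgroup.mem_bot.1 hx
  exact Subgroup.mem_bot.2 (congrArg Subtype.val (map_one φ))

theorem IsNormal.sup [Finite F.S] {R₁ R₂ : Subgroup G} (h₁ : F.IsNormal R₁)
    (h₂ : F.IsNormal R₂) : F.IsNormal (R₁ ⊔ R₂) := by
  have hle := sup_le h₁.le_S h₂.le_S
  refine IsNormal.of_extends hle ((le_inf h₁.S_le_normalizer h₂.S_le_normalizer).trans
    (Subgroup.normalizer_inf_normalizer_le_normalizer_sup _ _)) fun U V φ hφ => ?_
  obtain ⟨ψ, hψ, hψφ, hs⟩ := h₁.exists_extends hφ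
  obtain ⟨χ, hχ, hχψ, ht⟩ := h₂.exists_extends hψ
  have hs' := Stabilises.of_extends hχψ hs
  have := finite_of_le hle
  exact ⟨_, _, χ, hχ, hχψ.trans hψφ, Stabilises.of_apply_mem (F.injective hχ)
    (sup_le hs'.1 ht.1) fun x hx => apply_mem_sup (fun _ hA hx => hs'.apply_mem hx hA)
      (fun _ hA hx => ht.apply_mem hx hA) hs'.1 ht.1 hx _⟩

theorem IsNormal.le_Op (h : F.IsNormal R) : R ≤ F.Op :=
  le_sSup h

/-- The subgroup generated by all normal subgroups is normal. -/
theorem isNormal_Op [Finite F.S] : F.IsNormal F.Op := by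
  have hfin : {Q | F.IsNormal Q}.Finite := by
    refine (Set.finite_range fun K : Subgroup F.S => K.map F.S.subtype).subset fun Q hQ => ?_
    exact ⟨Q.subgroupOf F.S, Subgroup.map_subgroupOf_eq_of_le (IsNormal.le_S hQ)⟩
  obtain ⟨M, hM⟩ := hfin.exists_maximal ⟨⊥, isNormal_bot⟩
  have : F.Op = M := le_antisymm
    (sSup_le fun Q hQ => le_sup_right.trans (hM.2 (IsNormal.sup hM.1 hQ) le_sup_left)) hM.1.le_Op
  exact this ▸ hM.1

theorem Op_le_S [Finite F.S] : F.Op ≤ F.S :=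
  isNormal_Op.le_S

/-- `N_F(Q)` has `Q` as a normal subgroup. -/
theorem isNormal_normalizer (hQ : Q ≤ F.S) : (F.normalizer Q hQ).IsNormal Q := by
  refine IsNormal.of_extends (le_NS hQ) inf_le_right fun U V φ hφ => ?_
  obtain ⟨hU, hV, hφ, ψ, hψ, hext, hs⟩ := hφ
  exact ⟨_, _, ψ, mem_normalizer_of_extends hQ (sup_le hU (le_NS hQ)) (sup_le hV (le_NS hQ)) hψ
    ⟨le_rfl, fun x => rfl⟩ hs, hext, hs⟩

instance finite_normalizer [Finite F.S] (hQ : Q ≤ F.S) : Finite (F.normalizer Q hQ).S :=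
  finite_of_le (F := F) NS_le_S

/-- `Q` is weakly centric-radical if all normal subgroups of `N_F(Q)` lie in `Q`. -/
theorem isWeaklyCentricRadical_of_le [Finite F.S] (hQ : Q ≤ F.S)
    (h : ∀ R, (F.normalizer Q hQ).IsNormal R → Q ≤ R → R ≤ Q) : F.IsWeaklyCentricRadical Q :=
  have hle := (isNormal_normalizer hQ).le_Op
  ⟨hQ, le_antisymm (h _ isNormal_Op hle) hle⟩

theorem isWeaklyCentricRadical_S [Finite F.S] : F.IsWeaklyCentricRadical F.S :=
  isWeaklyCentricRadical_of_le le_rfl fun _ hR _ => hR.le_S.trans NS_le_S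

open scoped Pointwise in
/-- Weakly centric-radical subgroups contain all normal subgroups `R`: as `R ∩ N_S(P)` is normal in
`N_F(P)`, it lies in `P`, so `N_{PR}(P) = P` and hence `PR = P`. -/
theorem IsWeaklyCentricRadical.le_of_isNormal [Fact p.Prime] [Finite F.S]
    (hp : IsPGroup p F.S) (hP : F.IsWeaklyCentricRadical P) (hR : F.IsNormal R) : R ≤ P := by
  obtain ⟨hPS, hOp⟩ := hP
  have := finite_of_le hPS
  set K : Subgroup G := R ⊓ F.NS P with hK
  have hKS : K ≤ F.S := inf_le_left.trans hR.le_S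
  have := finite_of_le hKS
  have hnormal : (F.normalizer P hPS).IsNormal K := by
    refine IsNormal.of_extends inf_le_right ?_ fun U V φ hφ => ?_
    · intro g hg
      refine Subgroup.mem_normalizer_of_finite fun x hx => ⟨?_, ?_⟩
      · exact (Subgroup.mem_normalizer_iff.1 (hR.S_le_normalizer hg.1) x).1 hx.1
      · exact (F.NS P).mul_mem ((F.NS P).mul_mem hg hx.2) ((F.NS P).inv_mem hg)
    · obtain ⟨hU, hV, hφ, ψ, hψ, hψφ, hs⟩ := hφ
      obtain ⟨χ, hχ, hχψ, ht⟩ := hR.exists_extends hψ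
      have hs' := Stabilises.of_extends hχψ hs
      have hχφ := hχψ.trans hψφ
      have hKA : K ≤ U ⊔ P ⊔ R := inf_le_left.trans ht.1
      have hχK : Stabilises χ K := by
        refine Stabilises.of_apply_mem (F.injective hχ) hKA fun x hx => ?_
        refine ⟨ht.apply_mem hx.1 _, (F.le_of_mem hχ).2 (χ _).2, ?_⟩
        exact hs'.apply_mem_normalizer hx.2.2 _
      have hUK : U ⊔ K ≤ U ⊔ P ⊔ R := sup_le hχφ.1 hKA
      have hUK' : U ⊔ K ≤ F.NS P := sup_le hU inf_le_right
      have hVK' : V ⊔ K ≤ F.NS P := sup_le hV inf_le_right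
      obtain ⟨ω, hω, hχω⟩ := exists_restrict hχ hUK (hVK'.trans NS_le_S) fun x hx =>
        apply_mem_sup (U := U) (V := V) (fun x hA hx => by
          rw [hχφ.apply hx hA]
          exact (φ _).2) (fun _ hA hx => hχK.apply_mem hx hA) hχφ.1 hKA hx _
      refine ⟨_, _, ω, mem_normalizer_of_extends hPS hUK' hVK' hχ hχω hs',
        ⟨le_sup_left, fun x => ?_⟩, ?_⟩
      · rw [← hχφ.2 x, ← hχω.2]
        rfl
      · refine Stabilises.of_apply_mem (F.injective hω) le_sup_right fun x hx => ?_
        rw [← hχω.apply _ (hKA hx)]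
        exact hχK.apply_mem hx _
  have hKP : K ≤ P := hOp ▸ hnormal.le_Op
  by_contra hRP
  have hle : P ⊔ R ≤ F.S := sup_le hPS hR.le_S
  have := finite_of_le hle
  have hlt : P < P ⊔ R := lt_of_le_of_ne le_sup_left fun h => hRP (h ▸ le_sup_right)
  obtain ⟨g, hg, hgN, hgP⟩ := (hp.to_le hle).exists_mem_normalizer_notMem hlt
  have hg' : g ∈ (P : Set G) * (R : Set G) := by
    rw [← Subgroup.coe_mul_of_left_le_normalizer_right _ _ (hPS.trans hR.S_le_normalizer)]
    exact hg
  obtain ⟨a, ha, r, hr, rfl⟩ := hg'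
  refine hgP (mul_mem ha (hKP ⟨hr, hR.le_S hr, ?_⟩))
  simpa using mul_mem (inv_mem (Subgroup.le_normalizer (H := P) ha)) hgN

/-! ### Receptive and fully automised subgroups -/

theorem inv_mul_mem_centralizer {g h : G} (hgh : ∀ x ∈ Q, g * x * g⁻¹ = h * x * h⁻¹) :
    g⁻¹ * h ∈ Subgroup.centralizer (Q : Set G) := by
  refine Subgroup.mem_centralizer_iff.2 fun x hx => ?_
  have h1 : g * x * g⁻¹ * h = h * x := by rw [hgh x hx]; group
  rw [mul_assoc _ h x, ← h1]
  group

theorem mem_map_normalizerMonoidHom {K : Subgroup G} {α : MulAut Q} :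
    α ∈ (K.subgroupOf (Subgroup.normalizer (Q : Set G))).map Q.normalizerMonoidHom ↔
      ∃ g ∈ K ⊓ Subgroup.normalizer (Q : Set G), ∀ x : Q, (α x : G) = g * x * g⁻¹ := by
  constructor
  · rintro ⟨g, hg, rfl⟩
    exact ⟨g, ⟨hg, g.2⟩, fun x => rfl⟩
  · rintro ⟨g, hg, h⟩
    exact ⟨⟨g, hg.2⟩, hg.1, MulEquiv.ext fun x => Subtype.ext (h x).symm⟩

theorem mem_AutS {α : MulAut Q} :
    α ∈ F.AutS Q ↔ ∃ g ∈ F.NS Q, ∀ x : Q, (α x : G) = g * x * g⁻¹ :=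
  mem_map_normalizerMonoidHom

theorem mem_Nphi {φ : P ≃* Q} {g : G} (hg : g ∈ F.NS P)
    (h : ∃ k ∈ F.NS Q, ∀ x (hx : x ∈ P) (hx' : g * x * g⁻¹ ∈ P),
      (φ ⟨g * x * g⁻¹, hx'⟩ : G) = k * φ ⟨x, hx⟩ * k⁻¹) : g ∈ F.Nphi φ := by
  refine ⟨hg.1, ⟨g, hg.2⟩, ?_, rfl⟩
  obtain ⟨k, hk, h⟩ := h
  refine mem_AutS.2 ⟨k, hk, fun x => ?_⟩
  have h1 : φ ⟨φ.symm x, (φ.symm x).2⟩ = x := φ.apply_symm_apply x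
  have h2 := h (φ.symm x) (φ.symm x).2 ((Subgroup.mem_normalizer_iff.1 hg.2 _).1 (φ.symm x).2)
  rw [h1] at h2
  exact h2

theorem isPGroup_AutS (hp : IsPGroup p F.S) : IsPGroup p (F.AutS Q) :=
  IsPGroup.map hp.comap_subtype _

/-- If `W` is fully automised and receptive, then each conjugate `P` of `W` has an isomorphism onto
`W` which extends to `N_S(P)`: by Sylow's theorem, `Aut_S(P)` can be carried into `Aut_S(W)`. -/
theorem exists_isIso_extends_NS [Fact p.Prime] [Finite F.S] (hp : IsPGroup p F.S)
    (hW : F.IsFullyAutomised p W) (hW' : F.IsReceptive W) (hPW : F.IsConj P W) :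
    ∃ e : P ≃* W, F.IsIso e ∧ ∃ ψ ∈ F.Hom (F.NS P) F.S, Extends ψ e.toMonoidHom := by
  obtain ⟨hWS, T, hT⟩ := hW
  obtain ⟨φ, hφ⟩ := hPW
  have hPS := (F.le_of_mem hφ.1).1
  have := finite_of_le hWS
  let D : Subgroup (MulAut W) := (F.AutS P).map (MulAut.congr φ).toMonoidHom
  have hDA : D ≤ F.Aut W hWS := by
    rintro _ ⟨α, hα, rfl⟩
    obtain ⟨g, hg, h⟩ := mem_AutS.1 hα
    exact F.comp_mem hφ.2 (F.comp_mem (F.conj_mem hPS hPS g hg.1 α.toMonoidHom h) hφ.1)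
  have hD : IsPGroup p (D.subgroupOf (F.Aut W hWS)) :=
    IsPGroup.comap_subtype ((isPGroup_AutS hp).map _)
  obtain ⟨T', hT'⟩ := hD.exists_le_sylow
  obtain ⟨a, ha⟩ := MulAction.exists_smul_eq (F.Aut W hWS) T' T
  let e : P ≃* W := φ.trans a.1
  have he : F.IsIso e := hφ.trans (IsIso.of_mem a.2)
  have hle : F.NS P ≤ F.Nphi e := fun g hg => by
    refine mem_Nphi hg ?_
    let c : MulAut P := P.normalizerMonoidHom ⟨g, hg.2⟩
    have hc : c ∈ F.AutS P := ⟨⟨g, hg.2⟩, hg.1, rfl⟩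
    let d : F.Aut W hWS := ⟨MulAut.congr φ c, hDA ⟨c, hc, rfl⟩⟩
    have hd : d ∈ T' := hT' ⟨c, hc, rfl⟩
    have h1 : MulAut.conj a • d ∈ ((a • T' : Sylow p (F.Aut W hWS)) : Subgroup _) :=
      Subgroup.smul_mem_pointwise_smul _ _ _ hd
    rw [ha, hT] at h1
    obtain ⟨k, hk, h2⟩ := mem_AutS.1 (Subgroup.mem_subgroupOf.1 h1)
    refine ⟨k, hk, fun x hx hx' => ?_⟩
    have h3 := h2 (e ⟨x, hx⟩)
    rw [← h3]
    have h4 : (a.1)⁻¹ (e ⟨x, hx⟩) = φ ⟨x, hx⟩ := a.1.symm_apply_apply _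
    change _ = ((a.1 (φ (c (φ.symm ((a.1)⁻¹ (e ⟨x, hx⟩))))) : W) : G)
    rw [h4, φ.symm_apply_apply]
    rfl
  obtain ⟨ψ, hψ, hext⟩ := hW'.2 P e he
  obtain ⟨χ, hχ, hψχ⟩ := exists_restrict hψ hle le_rfl fun x hx => (ψ _).2
  exact ⟨e, he, χ, hχ, hψχ.of_le hext (le_NS hPS)⟩

theorem isFullyNormalised_of_isReceptive [Fact p.Prime] [Finite F.S] (hp : IsPGroup p F.S)
    (hW : F.IsFullyAutomised p W) (hW' : F.IsReceptive W) : F.IsFullyNormalised W := by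
  refine ⟨hW'.1, fun P hP => ?_⟩
  obtain ⟨e, he, ψ, hψ, hext⟩ := exists_isIso_extends_NS hp hW hW' hP
  have := finite_of_le hW'.1
  have := finite_of_le (F := F) (Q := F.NS W) NS_le_S
  refine Nat.card_le_card_of_injective (fun g : F.NS P => (⟨ψ g, (ψ g).2,
    hext.apply_mem_normalizer g.2.2 g.2⟩ : F.NS W)) fun g g' h => F.injective hψ ?_
  exact Subtype.ext (congrArg (fun x : F.NS W => (x : G)) h)

theorem isCentric_of_centralizer_le [Fact p.Prime] [Finite F.S] (hp : IsPGroup p F.S)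
    (hW : F.IsFullyAutomised p W) (hW' : F.IsReceptive W)
    (hC : F.S ⊓ Subgroup.centralizer (W : Set G) ≤ W) : F.IsCentric W := by
  refine ⟨hW'.1, fun P hP => ?_⟩
  obtain ⟨e, he, ψ, hψ, hext⟩ := exists_isIso_extends_NS hp hW hW' hP
  have hPS := (F.le_of_mem he.1).1
  refine le_antisymm (fun c hc => ?_) ?_
  · have hcN : c ∈ F.NS P := ⟨hc.1, Subgroup.centralizer_le_normalizer _ hc.2⟩
    have hψc : (ψ ⟨c, hcN⟩ : G) ∈ W := by
      refine hC ⟨(ψ _).2, Subgroup.mem_centralizer_iff.2 fun w hw => ?_⟩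
      obtain ⟨x, hx⟩ := e.surjective ⟨w, hw⟩
      have hxw : (ψ ⟨x, le_NS hPS x.2⟩ : G) = w :=
        (hext.apply x.2 _).trans (congrArg Subtype.val hx)
      rw [← hxw, ← Subgroup.coe_mul, ← Subgroup.coe_mul, ← map_mul, ← map_mul]
      congr 2
      exact Subtype.ext (Subgroup.mem_centralizer_iff.1 hc.2 x x.2)
    obtain ⟨x, hx⟩ := e.surjective ⟨_, hψc⟩
    have hxc : ψ ⟨x, le_NS hPS x.2⟩ = ψ ⟨c, hcN⟩ :=
      Subtype.ext ((hext.apply x.2 _).trans (congrArg Subtype.val hx))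
    have hcP : c ∈ P := by
      have := congrArg (fun y : F.NS P => (y : G)) (F.injective hψ hxc)
      rw [← show (x : G) = c from this]
      exact x.2
    refine ⟨⟨c, hcP⟩, Subgroup.mem_center_iff.2 fun y => Subtype.ext ?_, rfl⟩
    exact Subgroup.mem_centralizer_iff.1 hc.2 y y.2
  · rintro _ ⟨c, hc, rfl⟩
    refine ⟨hPS c.2, Subgroup.mem_centralizer_iff.2 fun y hy => ?_⟩
    exact congrArg Subtype.val (Subgroup.mem_center_iff.1 hc ⟨y, hy⟩)

/-! ### Morphisms that extend to `S` -/

/-- `φ` is a restriction of an automorphism of `S` in `F`. -/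
def LiftsToS (F : FusionSystem G) (φ : U →* V) : Prop :=
  ∃ ψ : F.S ≃* F.S, F.IsIso ψ ∧ Extends ψ.toMonoidHom φ

theorem LiftsToS.of_extends {ψ : A →* B} {φ : U →* V} (h : F.LiftsToS ψ) (h' : Extends ψ φ) :
    F.LiftsToS φ :=
  let ⟨χ, hχ, hext⟩ := h
  ⟨χ, hχ, hext.trans h'⟩

theorem LiftsToS.comp {φ : U →* V} {ψ : V →* W} (h : F.LiftsToS φ) (h' : F.LiftsToS ψ) :
    F.LiftsToS (ψ.comp φ) := by
  obtain ⟨χ, hχ, h⟩ := h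
  obtain ⟨ω, hω, h'⟩ := h'
  refine ⟨χ.trans ω, hχ.trans hω, h.1, fun x => ?_⟩
  have h1 : χ (Subgroup.inclusion h.1 x) = Subgroup.inclusion h'.1 (φ x) := Subtype.ext (h.2 x)
  change ((ω (χ (Subgroup.inclusion h.1 x)) : F.S) : G) = ψ (φ x)
  rw [h1]
  exact h'.2 (φ x)

theorem LiftsToS.symm {e : U ≃* V} (hV : V ≤ F.S) (h : F.LiftsToS e.toMonoidHom) :
    F.LiftsToS e.symm.toMonoidHom := by
  obtain ⟨χ, hχ, h⟩ := h
  refine ⟨χ.symm, hχ.symm, hV, fun y => ?_⟩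
  obtain ⟨x, rfl⟩ := e.surjective y
  have h1 : Subgroup.inclusion hV (e x) = χ (Subgroup.inclusion h.1 x) :=
    Subtype.ext (h.2 x).symm
  change ((χ.symm (Subgroup.inclusion hV (e x)) : F.S) : G) = (e.symm (e x) : G)
  rw [h1, χ.symm_apply_apply, e.symm_apply_apply]
  rfl

theorem LiftsToS.of_conj (hU : U ≤ F.S) {φ : U →* V} {g : G} (hg : g ∈ F.S)
    (h : ∀ x : U, (φ x : G) = g * x * g⁻¹) : F.LiftsToS φ :=
  ⟨MulAut.conj ⟨g, hg⟩, IsIso.of_mem (F.conj_mem le_rfl le_rfl g hg _ fun _ => rfl), hU,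
    fun x => (h x).symm⟩

/-- The inductive step of Alperin's fusion theorem. Let `W < S` be fully automised, receptive and
not essential, and let all morphisms defined on subgroups properly containing `W` extend to `S`.
Then the automorphisms of `W` extend to `S`, since otherwise those which do would form a subgroup of
`Aut_F(W)` whose image in `Out_F(W)` is strongly `p`-embedded. -/
theorem liftsToS_of_mem_Aut [Fact p.Prime] [Finite F.S] (hp : IsPGroup p F.S)
    (hW : F.IsFullyAutomised p W) (hW' : F.IsReceptive W) (hWS : W < F.S)
    (hess : ¬ F.IsEssential p W)
    (ih : ∀ (A B : Subgroup G), ∀ χ ∈ F.Hom A B, W < A → F.LiftsToS χ)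
    {α : MulAut W} (hα : α ∈ F.Aut W hWS.le) : F.LiftsToS α.toMonoidHom := by
  have step {α : MulAut W} (hα : α ∈ F.Aut W hWS.le) {g : G} (hg : g ∈ F.Nphi α) (hgW : g ∉ W) :
      F.LiftsToS α.toMonoidHom := by
    obtain ⟨ψ, hψ, hext⟩ := hW'.2 W α (IsIso.of_mem hα)
    exact (ih _ _ ψ hψ (lt_of_le_of_ne hext.1 fun h => hgW (h ▸ hg))).of_extends hext
  by_cases hC : F.S ⊓ Subgroup.centralizer (W : Set G) ≤ W
  swap
  · -- elements that centralise `W` lie in all the groups `N_α`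
    obtain ⟨g, hg, hgW⟩ := SetLike.not_le_iff_exists.1 hC
    refine step hα (mem_Nphi ⟨hg.1, Subgroup.centralizer_le_normalizer _ hg.2⟩
      ⟨1, one_mem _, fun x hx hx' => ?_⟩) hgW
    have h1 : g * x * g⁻¹ = x :=
      mul_inv_eq_of_eq_mul (Subgroup.mem_centralizer_iff.1 hg.2 x hx).symm
    have h2 : (⟨g * x * g⁻¹, hx'⟩ : W) = ⟨x, hx⟩ := Subtype.ext h1
    rw [h2]
    simp
  have hcentric := isCentric_of_centralizer_le hp hW hW' hC
  have hnormalised := isFullyNormalised_of_isReceptive hp hW hW'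
  have := finite_of_le hWS.le
  obtain ⟨_, T, hT⟩ := hW
  let H : Subgroup (F.Aut W hWS.le) :=
    { carrier := {β | F.LiftsToS β.1.toMonoidHom}
      one_mem' := LiftsToS.of_conj hWS.le F.S.one_mem fun x => by simp
      mul_mem' := fun ha hb => LiftsToS.comp hb ha
      inv_mem' := fun ha => LiftsToS.symm hWS.le ha }
  have hmemT (β : F.Aut W hWS.le) :
      β ∈ T ↔ ∃ g ∈ F.NS W, ∀ x : W, (β.1 x : G) = g * x * g⁻¹ := by
    rw [← mem_AutS, ← Subgroup.mem_subgroupOf, ← hT]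
    rfl
  let N : Subgroup (F.Aut W hWS.le) := (MulAut.conj : W →* MulAut W).range.subgroupOf _
  have hmemN (β : F.Aut W hWS.le) {g : G} (hg : g ∈ W) (h : ∀ x : W, (β.1 x : G) = g * x * g⁻¹) :
      β ∈ N :=
    Subgroup.mem_subgroupOf.2 ⟨⟨g, hg⟩, MulEquiv.ext fun x => Subtype.ext (h x).symm⟩
  suffices hH : H = ⊤ by
    have : (⟨α, hα⟩ : F.Aut W hWS.le) ∈ H := hH ▸ Subgroup.mem_top _
    exact this
  by_contra hH
  refine hess ⟨hnormalised, hcentric, hWS.le,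
    HasStronglyEmbedded.quotient_of_sylow N T H ?_ ?_ hH ?_⟩
  · refine SetLike.lt_iff_le_and_exists.2 ⟨fun β hβ => ?_, ?_⟩
    · obtain ⟨w, hw⟩ := Subgroup.mem_subgroupOf.1 hβ
      exact (hmemT β).2 ⟨w, le_NS hWS.le w.2, fun x => by rw [← hw]; rfl⟩
    · obtain ⟨g, hgS, hgN, hgW⟩ := hp.exists_mem_normalizer_notMem hWS
      let β : MulAut W := W.normalizerMonoidHom ⟨g, hgN⟩
      have hβ : β ∈ F.Aut W hWS.le := F.conj_mem hWS.le hWS.le g hgS _ fun _ => rfl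
      refine ⟨⟨β, hβ⟩, (hmemT _).2 ⟨g, ⟨hgS, hgN⟩, fun _ => rfl⟩, fun h => hgW ?_⟩
      obtain ⟨w, hw⟩ := Subgroup.mem_subgroupOf.1 h
      have hwg : (w : G)⁻¹ * g ∈ W := by
        refine hC ⟨F.S.mul_mem (F.S.inv_mem (hWS.le w.2)) hgS,
          inv_mul_mem_centralizer fun x hx => ?_⟩
        exact congrArg (fun γ : MulAut W => (γ ⟨x, hx⟩ : G)) hw
      simpa using mul_mem w.2 hwg
  · intro β hβ
    obtain ⟨g, hg, h⟩ := (hmemT β).1 hβ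
    exact LiftsToS.of_conj hWS.le hg.1 h
  · intro k t ht htN hkt
    obtain ⟨g, hg, h⟩ := (hmemT t).1 ht
    obtain ⟨g', hg', h'⟩ := (hmemT _).1 hkt
    refine step k.2 (mem_Nphi hg ⟨g', hg', fun x hx hx' => ?_⟩) fun hgW => htN (hmemN t hgW h)
    have h1 := h' (k.1 ⟨x, hx⟩)
    have h2 : (k.1)⁻¹ (k.1 ⟨x, hx⟩) = ⟨x, hx⟩ := k.1.symm_apply_apply _
    change ((k.1 (t.1 ((k.1)⁻¹ (k.1 ⟨x, hx⟩))) : W) : G) = _ at h1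
    rw [h2] at h1
    rw [← h1]
    congr 2
    exact Subtype.ext (h ⟨x, hx⟩).symm

/-- A form of Alperin's fusion theorem: if `O_p(F)` is the only essential subgroup, if any, then all
morphisms defined on subgroups properly containing `O_p(F)` extend to automorphisms of `S`. -/
theorem liftsToS_of_Op_lt [Fact p.Prime] [Finite F.S] (hp : IsPGroup p F.S)
    (hF : F.IsSaturated p) (hess : ∀ Q, F.IsEssential p Q → Q = F.Op) {φ : U →* V}
    (hφ : φ ∈ F.Hom U V) (hU : F.Op < U) : F.LiftsToS φ := by
  induction hn : Nat.card F.S - Nat.card U using Nat.strong_induction_on generalizing U V with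
  | _ n ih =>
    subst hn
    have hUS := (F.le_of_mem hφ).1
    have ih' {P : Subgroup G} (hPU : Nat.card P = Nat.card U) (hP : F.Op < P) (A B : Subgroup G)
        (χ : A →* B) (hχ : χ ∈ F.Hom A B) (hPA : P < A) : F.LiftsToS χ := by
      have hA := (F.le_of_mem hχ).1
      have := finite_of_le hA
      have h1 : Nat.card A ≤ Nat.card F.S :=
        Nat.card_le_card_of_injective _ (Subgroup.inclusion_injective hA)
      have h2 : Nat.card P < Nat.card A := by
        by_contra! h
        exact hPA.ne (Subgroup.eq_of_le_of_card_ge hPA.le h)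
      exact ih _ (by omega) hχ (hP.trans hPA) rfl
    obtain ⟨V', hV', e, he, -, rfl⟩ := F.exists_iso hφ
    have he' : F.IsIso e := IsIso.of_mem he
    have hV'S := (F.le_of_mem he).2
    rcases hUS.eq_or_lt with rfl | hlt
    · have hV'eq : V' = F.S :=
        Subgroup.eq_of_le_of_card_ge hV'S (Nat.card_congr e.toEquiv).le
      subst hV'eq
      exact ⟨e, he', le_rfl, fun x => rfl⟩
    obtain ⟨W, hUW, hW, hW'⟩ := hF U hUS
    -- isomorphisms of conjugates of `O_p(F) < U < S` onto `W` which extend to `S`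
    have key {P : Subgroup G} (f : U ≃* P) (hf : F.IsIso f) :
        F.Op < P ∧ P < F.S ∧ ∃ d : P ≃* W, F.IsIso d ∧ F.LiftsToS d.toMonoidHom := by
      have hcard : Nat.card P = Nat.card U := (Nat.card_congr f.toEquiv).symm
      have hPS := (F.le_of_mem hf.1).2
      have hPlt : P < F.S := lt_of_le_of_ne hPS fun h => hlt.ne
        (Subgroup.eq_of_le_of_card_ge hlt.le (by rw [← h, hcard]))
      have hOP : F.Op ≤ P := fun y hy => by
        obtain ⟨x, hx, -, rfl⟩ := (isNormal_Op.stabilises hf.1 hU.le).exists_apply_eq hy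
        exact (f _).2
      have := finite_of_le hUS
      have := finite_of_le (F := F) Op_le_S
      have hOP' : F.Op < P := lt_of_le_of_ne hOP fun h => hU.ne
        (Subgroup.eq_of_le_of_card_ge hU.le (by rw [h, hcard]))
      have hconj : F.IsConj P W := by
        obtain ⟨d, hd⟩ := hUW
        exact ⟨f.symm.trans d, hf.symm.trans hd⟩
      obtain ⟨d, hd, ψ, hψ, hext⟩ := exists_isIso_extends_NS hp hW hW' hconj
      obtain ⟨g, hgS, hgN, hgP⟩ := hp.exists_mem_normalizer_notMem hPlt
      refine ⟨hOP', hPlt, d, hd, (ih' hcard hOP' _ _ ψ hψ ?_).of_extends hext⟩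
      exact lt_of_le_of_ne (le_NS hPS) fun h => hgP (h ▸ ⟨hgS, hgN⟩)
    obtain ⟨d, hd⟩ := hUW
    obtain ⟨hOW, hWlt, -⟩ := key d hd
    obtain ⟨-, -, d₁, hd₁, hl₁⟩ := key (MulEquiv.refl U)
      (IsIso.of_mem (F.conj_mem hUS hUS 1 F.S.one_mem _ fun x => by simp))
    obtain ⟨-, -, d₂, hd₂, hl₂⟩ := key e he'
    let α : MulAut W := d₁.symm.trans (e.trans d₂)
    have hα : α ∈ F.Aut W hWlt.le := (hd₁.symm.trans (he'.trans hd₂)).1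
    have hl := liftsToS_of_mem_Aut hp hW hW' hWlt (fun h => hOW.ne' (hess W h))
      (ih' (Nat.card_congr d.toEquiv).symm hOW) hα
    have heq : e.toMonoidHom =
        d₂.symm.toMonoidHom.comp (α.toMonoidHom.comp d₁.toMonoidHom) := by
      ext x
      simp [α]
    have hle : F.LiftsToS e.toMonoidHom := by
      rw [heq]
      exact (hl₁.comp hl).comp (hl₂.symm hWlt.le)
    obtain ⟨ψ, hψ, hext⟩ := hle
    exact ⟨ψ, hψ, hext.1, fun x => hext.2 x⟩

/-! ### Essential subgroups -/

theorem lt_NS [Fact p.Prime] [Finite F.S] (hp : IsPGroup p F.S) (hQ : Q < F.S) : Q < F.NS Q := by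
  obtain ⟨g, hgS, hgN, hgQ⟩ := hp.exists_mem_normalizer_notMem hQ
  exact lt_of_le_of_ne (le_NS hQ.le) fun h => hgQ (h ▸ ⟨hgS, hgN⟩)

/-- As `Aut_S(S) = Inn(S)` is a Sylow subgroup of `Aut_F(S)`, the order of `Out_F(S)` is prime
to `p`. -/
theorem IsEssential.ne_S [Fact p.Prime] [Finite F.S] (hF : F.IsSaturated p)
    (hQ : F.IsEssential p Q) : Q ≠ F.S := by
  rintro rfl
  obtain ⟨-, -, hS, H, -, hpH, -⟩ := hQ
  obtain ⟨P, ⟨e, he⟩, ⟨hP, T, hT⟩, -⟩ := hF F.S le_rfl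
  have hPS : P = F.S := Subgroup.eq_of_le_of_card_ge hP (Nat.card_congr e.toEquiv).le
  subst hPS
  have hle : (T : Subgroup (F.Aut F.S hS)) ≤
      (MulAut.conj : F.S →* MulAut F.S).range.subgroupOf (F.Aut F.S hS) := fun β hβ => by
    rw [hT] at hβ
    obtain ⟨g, hg, h⟩ := mem_AutS.1 (Subgroup.mem_subgroupOf.1 hβ)
    exact Subgroup.mem_subgroupOf.2
      ⟨⟨g, hg.1⟩, MulEquiv.ext fun x => Subtype.ext (h x).symm⟩
  exact T.not_dvd_index ((hpH.trans H.card_subgroup_dvd_card).trans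
    (Subgroup.index_dvd_of_le hle))

/-- A normal subgroup `R ≥ Q` of `N_F(Q)` induces a normal `p`-subgroup of `Out_F(Q)`, which is
trivial if `Q` is essential; hence `R ≤ Q C_S(Q) = Q`. -/
theorem IsEssential.isWeaklyCentricRadical [Fact p.Prime] [Finite F.S] (hp : IsPGroup p F.S)
    (hQ : F.IsEssential p Q) : F.IsWeaklyCentricRadical Q := by
  obtain ⟨-, hcentric, hQS, hemb⟩ := hQ
  have := finite_of_le hQS
  refine isWeaklyCentricRadical_of_le hQS fun R hR hQR => ?_
  have hRS : R ≤ F.S := hR.le_S.trans NS_le_S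
  let D : Subgroup (F.Aut Q hQS) :=
    ((R.subgroupOf (Subgroup.normalizer (Q : Set G))).map Q.normalizerMonoidHom).subgroupOf _
  have hmemD (β : F.Aut Q hQS) : β ∈ D ↔
      ∃ g ∈ R ⊓ Subgroup.normalizer (Q : Set G), ∀ x : Q, (β.1 x : G) = g * x * g⁻¹ :=
    Subgroup.mem_subgroupOf.trans mem_map_normalizerMonoidHom
  have hDp : IsPGroup p D :=
    IsPGroup.comap_subtype (IsPGroup.map (hp.to_le hRS).comap_subtype _)
  have hDn : D.Normal := by
    refine ⟨fun d hd a => (hmemD _).2 ?_⟩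
    obtain ⟨r, hr, h⟩ := (hmemD d).1 hd
    have ha : a.1.toMonoidHom ∈ (F.normalizer Q hQS).Hom Q Q :=
      mem_normalizer_of_extends hQS (le_NS hQS) (le_NS hQS) a.2 ⟨le_rfl, fun _ => rfl⟩
        (Stabilises.of_apply_mem (F.injective a.2) le_rfl fun _ _ => (a.1 _).2)
    obtain ⟨ψ, hψ, hext, hs⟩ := hR.exists_extends ha
    have hrA : r ∈ Q ⊔ R := hs.1 hr.1
    refine ⟨ψ ⟨r, hrA⟩, ⟨hs.apply_mem hr.1 _,
      hext.apply_mem_normalizer (φ := a.1) hr.2 hrA⟩, fun x => ?_⟩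
    obtain ⟨y, rfl⟩ := a.1.surjective x
    have h1 : (a.1)⁻¹ (a.1 y) = y := a.1.symm_apply_apply y
    change ((a.1 (d.1 ((a.1)⁻¹ (a.1 y))) : Q) : G) = _
    have hyA : (y : G) ∈ Q ⊔ R := (le_sup_left : Q ≤ Q ⊔ R) y.2
    have h2 : (ψ ⟨y, hyA⟩ : G) = a.1 y := hext.apply y.2 hyA
    rw [h1, ← h2, ← Subgroup.coe_inv, ← Subgroup.coe_mul, ← Subgroup.coe_mul, ← map_inv,
      ← map_mul, ← map_mul]
    have hdyA : (d.1 y : G) ∈ Q ⊔ R := (le_sup_left : Q ≤ Q ⊔ R) (d.1 y).2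
    refine (hext.apply (d.1 y).2 hdyA).symm.trans ?_
    congr 2
    exact Subtype.ext (h y)
  let N : Subgroup (F.Aut Q hQS) := (MulAut.conj : Q →* MulAut Q).range.subgroupOf _
  have hDN : (D.map (QuotientGroup.mk' N)).Normal :=
    hDn.map _ (QuotientGroup.mk'_surjective N)
  have hbot : D.map (QuotientGroup.mk' N) = ⊥ := hemb.eq_bot_of_normal _ (hDp.map _)
  have key {r : G} (hr : r ∈ R) : r ∈ Q := by
    have hrN : r ∈ Subgroup.normalizer (Q : Set G) := (hR.le_S hr).2
    let c : F.Aut Q hQS := ⟨Q.normalizerMonoidHom ⟨r, hrN⟩,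
      F.conj_mem hQS hQS r (hRS hr) _ fun _ => rfl⟩
    have hc : QuotientGroup.mk' N c ∈ D.map (QuotientGroup.mk' N) :=
      ⟨c, (hmemD c).2 ⟨r, ⟨hr, hrN⟩, fun _ => rfl⟩, rfl⟩
    rw [hbot] at hc
    obtain ⟨q, hq⟩ := Subgroup.mem_subgroupOf.1 ((QuotientGroup.eq_one_iff c).1 hc)
    have hqr : (q : G)⁻¹ * r ∈ F.S ⊓ Subgroup.centralizer (Q : Set G) := by
      refine ⟨F.S.mul_mem (F.S.inv_mem (hQS q.2)) (hRS hr),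
        inv_mul_mem_centralizer fun x hx => ?_⟩
      exact congrArg (fun γ : MulAut Q => (γ ⟨x, hx⟩ : G)) hq
    rw [hcentric.2 Q ⟨MulEquiv.refl Q,
      IsIso.of_mem (F.conj_mem hQS hQS 1 F.S.one_mem _ fun x => by simp)⟩] at hqr
    obtain ⟨z, -, hz⟩ := hqr
    have hz : (z : G) = (q : G)⁻¹ * r := hz
    have hrq : r = q * z := by rw [hz, mul_inv_cancel_left]
    rw [hrq]
    exact mul_mem q.2 z.2
  exact fun r hr => key hr

/-- If all morphisms on subgroups properly containing `O_p(F)` extend to `S`, then `N_S(Q)` is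
normal in `N_F(Q)` for `O_p(F) < Q`, so `Q < S` is not weakly centric-radical. -/
theorem exists_isEssential_ne_Op [Fact p.Prime] [Finite F.S] (hp : IsPGroup p F.S)
    (hF : F.IsSaturated p) (hQ : F.IsWeaklyCentricRadical Q) (hOQ : F.Op < Q) (hQS : Q < F.S) :
    ∃ E, F.IsEssential p E ∧ E ≠ F.Op := by
  by_contra! hess
  obtain ⟨hQS', hOp⟩ := hQ
  have := finite_of_le hQS'
  have := finite_of_le (F := F) (Q := F.NS Q) NS_le_S
  have hnormal : (F.normalizer Q hQS').IsNormal (F.NS Q) := by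
    refine IsNormal.of_extends le_rfl Subgroup.le_normalizer fun U V φ hφ => ?_
    obtain ⟨hU, hV, -, ψ, hψ, hext, hs⟩ := hφ
    obtain ⟨ω, hω, hωψ⟩ := liftsToS_of_Op_lt hp hF hess hψ (hOQ.trans_le le_sup_right)
    have ht := Stabilises.of_extends hωψ hs
    obtain ⟨χ, hχ, hωχ⟩ := exists_restrict hω.1 (NS_le_S (F := F) (Q := Q)) NS_le_S
      fun x hx => ⟨(ω _).2, ht.apply_mem_normalizer hx.2 _⟩
    exact ⟨_, _, χ, mem_normalizer_of_extends hQS' le_rfl le_rfl hω.1 hωχ ht,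
      hωχ.of_le (hωψ.trans hext) hU,
      Stabilises.of_apply_mem (F.injective hχ) le_rfl fun _ _ => (χ _).2⟩
  exact (lt_NS hp hQS).not_ge (hnormal.le_Op.trans hOp.le)

/-! ### Chains and the rank -/

theorem isWeaklyCentricRadicalChain_Op [Finite F.S] {L : List (Subgroup G)}
    (hL : (F.Op :: L).IsChain (· < ·)) (h : SuccessivelyRadical F L) :
    F.IsWeaklyCentricRadicalChain F.Op L := by
  obtain ⟨hO, heq⟩ := isNormal_Op (F := F)
  refine ⟨hL, ⟨hO, heq, heq.symm ▸ h⟩, fun Q hQ => ?_⟩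
  cases L with
  | nil => simp at hQ
  | cons A L =>
    obtain rfl : A = Q := by simpa using hQ
    exact (List.isChain_cons_cons.1 hL).1

theorem IsWeaklyCentricRadicalChain.successivelyRadical {Q₀ : Subgroup G}
    {L : List (Subgroup G)} (h : F.IsWeaklyCentricRadicalChain Q₀ L) :
    SuccessivelyRadical F L := by
  obtain ⟨-, ⟨hQ, heq, h⟩, -⟩ := h
  rwa [heq] at h

theorem weakRank_le_iff {n : ℕ∞} : F.weakRank ≤ n ↔
    ∀ Q₀ L, F.IsWeaklyCentricRadicalChain Q₀ L → (L.length : ℕ∞) ≤ n := by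
  simp only [weakRank, iSup_le_iff]

theorem length_le_weakRank {Q₀ : Subgroup G} {L : List (Subgroup G)}
    (h : F.IsWeaklyCentricRadicalChain Q₀ L) : (L.length : ℕ∞) ≤ F.weakRank :=
  weakRank_le_iff.1 le_rfl Q₀ L h

/-- If `O_p(F) < Q < S` with `Q` weakly centric-radical, then `O_p(F) < Q < N_S(Q)` is a weakly
centric-radical chain. -/
theorem two_le_weakRank_iff [Fact p.Prime] [Finite F.S] (hp : IsPGroup p F.S) :
    2 ≤ F.weakRank ↔ ∃ Q, F.IsWeaklyCentricRadical Q ∧ F.Op < Q ∧ Q < F.S := by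
  constructor
  · intro h
    by_contra! hQ
    have hle : F.weakRank ≤ 1 := by
      refine weakRank_le_iff.2 fun Q₀ L hL => ?_
      match L with
      | [] => simp
      | [_] => simp
      | A :: B :: L =>
        obtain ⟨hA, hAr, hB, -⟩ := hL.successivelyRadical
        have hAB := (List.isChain_cons_cons.1 (List.isChain_cons_cons.1 hL.1).2).1
        exact absurd (hAB.trans_le (hB.trans NS_le_S)) (hQ A hAr (hL.2.2 A rfl))
    exact absurd (h.trans hle) (by decide)
  · rintro ⟨Q, hQ, hOQ, hQS⟩
    refine length_le_weakRank (isWeaklyCentricRadicalChain_Op (L := [Q, F.NS Q]) ?_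
      ⟨hQS.le, hQ, le_rfl, isWeaklyCentricRadical_S, trivial⟩)
    simp [hOQ, lt_NS hp hQS]

/-- Weakly centric-radical subgroups of `N_F(Q)` contain `Q`, so one which is neither `Q` nor
`N_S(Q)` gives a chain of length three. -/
theorem weakRank_le_two_iff [Fact p.Prime] [Finite F.S] (hp : IsPGroup p F.S) :
    F.weakRank ≤ 2 ↔ ∀ (Q : Subgroup G) (hQ : Q ≤ F.S), F.IsWeaklyCentricRadical Q → Q ≠ F.S →
      Q ≠ F.Op → ∀ P : Subgroup G, (F.normalizer Q hQ).IsWeaklyCentricRadical P →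
        P = Q ∨ P = F.NS Q := by
  constructor
  · intro h Q hQ hQr hQS hQO P hP
    by_contra! hne
    have hpN : IsPGroup p (F.normalizer Q hQ).S := hp.to_le NS_le_S
    have hOQ : F.Op < Q := lt_of_le_of_ne (hQr.le_of_isNormal hp isNormal_Op) hQO.symm
    have hQP : Q < P :=
      lt_of_le_of_ne (hP.le_of_isNormal hpN (isNormal_normalizer hQ)) hne.1.symm
    obtain ⟨hPN, -⟩ := id hP
    have hPlt : P < (F.normalizer Q hQ).S := lt_of_le_of_ne hPN hne.2
    have hlen := (length_le_weakRank (isWeaklyCentricRadicalChain_Op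
      (L := [Q, P, (F.normalizer Q hQ).NS P]) (by simp [hOQ, hQP, lt_NS hpN hPlt])
      ⟨hQ, hQr, hPN, hP, le_rfl, isWeaklyCentricRadical_S, trivial⟩)).trans h
    exact absurd hlen (show ¬ ((3 : ℕ) : ℕ∞) ≤ 2 by decide)
  · intro h
    refine weakRank_le_iff.2 fun Q₀ L hL => ?_
    match L with
    | [] => simp
    | [_] => simp
    | [_, _] => simp
    | A :: B :: C :: L =>
      exfalso
      obtain ⟨hA, hAr, hB, hBr, hC, -⟩ := hL.successivelyRadical
      have hAB := List.isChain_cons_cons.1 (List.isChain_cons_cons.1 hL.1).2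
      have hBC := (List.isChain_cons_cons.1 hAB.2).1
      have hBN : B < F.NS A := hBC.trans_le (hC.trans NS_le_S)
      rcases h A hA hAr (hAB.1.trans_le (hB.trans NS_le_S)).ne (hL.2.2 A rfl).ne' B hBr with h | h
      · exact hAB.1.ne' h
      · exact hBN.ne h

end FusionSystem

theorem mainTheorem8 {G : Type*} [Group G] (p : ℕ) [Fact p.Prime] (F : FusionSystem G)
    [Finite F.S] (hp : IsPGroup p F.S) (hF : F.IsSaturated p) :
    F.weakRank = 2 ↔
      (∃ Q : Subgroup G, F.IsEssential p Q ∧ Q ≠ F.Op) ∧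
      ∀ (Q : Subgroup G) (hQ : Q ≤ F.S), F.IsWeaklyCentricRadical Q → Q ≠ F.S → Q ≠ F.Op →
        ∀ P : Subgroup G, (F.normalizer Q hQ).IsWeaklyCentricRadical P → P = Q ∨ P = F.NS Q := by
  rw [le_antisymm_iff, and_comm, FusionSystem.weakRank_le_two_iff hp,
    FusionSystem.two_le_weakRank_iff hp]
  refine and_congr_left fun _ => ⟨?_, ?_⟩
  · rintro ⟨Q, hQ, hOQ, hQS⟩
    exact FusionSystem.exists_isEssential_ne_Op hp hF hQ hOQ hQS
  · rintro ⟨Q, hQ, hne⟩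
    have hQr := hQ.isWeaklyCentricRadical hp
    exact ⟨Q, hQr, lt_of_le_of_ne (hQr.le_of_isNormal hp FusionSystem.isNormal_Op) hne.symm,
      lt_of_le_of_ne hQ.1.1 (hQ.ne_S hF)⟩
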